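/- Let $d_A,d_B\ge 2$ be integers, $d=\min(d_A,d_B)$, and let $\rho$ be a bipartite state on $\mathbb{C}^{d_A}\otimes\mathbb{C}^{d_B}$, i.e. a positive semidefinite complex matrix of trace one. Let $\mu\in\mathbb{R}^n$ and $\nu\in\mathbb{R}^m$ be arbitrary real column vectors, with Euclidean norms $|\mu|,|\nu|$. Let $\rho_A=\operatorname{Tr}_B\rho$ and $\rho_B=\operatorname{Tr}_A\rho$ be the reduced matrices, let $\operatorname{Vec}$ be the column-stacking vectorization, and let $\mathcal{R}(\rho)$ be the realigned matrix of $\rho$: writing $\rho$ as a $d_A\times d_A$ block matrix with blocks $\rho_{i,j}\in\mathbb{C}^{d_B\times d_B}$, $\mathcal{R}(\rho)$ is the $d_A^2\times d_B^2$ matrix with rows $\operatorname{Vec}(\rho_{1,1})^T,\ldots,\operatorname{Vec}(\rho_{d_A,1})^T,\ldots,\operatorname{Vec}(\rho_{1,d_A})^T,\ldots,\operatorname{Vec}(\rho_{d_A,d_A})^T$. Put $$\mathcal{Q}_{\mu,\nu}(\rho)=\begin{pmatrix}\mu\nu^T & \mu\operatorname{Vec}(\rho_B)^T\\ \operatorname{Vec}(\rho_A)\nu^T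 & \mathcal{R}(\rho)\end{pmatrix}.$$ Write $\|M\|_{\mathrm{Tr}}=\operatorname{Tr}\sqrt{M^\dagger M}$ for the trace norm. For a unit vector $|\varphi\rangle\in\mathbb{C}^{d_A}\otimes\mathbb{C}^{d_B}$ let $C(|\varphi\rangle)=\sqrt{2\bigl(1-\operatorname{Tr}\bigl((\operatorname{Tr}_B|\varphi\rangle\langle\varphi|)^2\bigr)\bigr)}$, and let the concurrence $C(\rho)$ be the minimum (infimum) of $\sum_i p_iC(|\varphi_i\rangle)$ over all finite decompositions $\rho=\sum_i p_i|\varphi_i\rangle\langle\varphi_i|$ with unit vectors $|\varphi_i\rangle$, $p_i\ge 0$ and $\sum_i p_i=1$. Then $$C(\rho)\ \ge\ \frac{\sqrt{2}}{\sqrt{d(d-1)}}\left(\|\mathcal{Q}_{\mu,\nu}(\rho)\|_{\mathrm{Tr}}-\sqrt{(|\mu|^2+1)(|\nu|^2+1)}\right).$$ -/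

import Mathlib

open scoped Matrix MatrixOrder ComplexOrder

noncomputable section

namespace BipartiteState

/-- A density matrix (quantum state): a positive semidefinite matrix of trace one. -/
structure IsDensityMatrix {S : Type*} [Fintype S] (ρ : Matrix S S ℂ) : Prop where
  posSemidef : ρ.PosSemidef
  trace_eq_one : ρ.trace = 1

/-- The trace norm `Tr √(M† M)` of a (possibly rectangular) complex matrix. -/
def traceNorm {R S : Type*} [Fintype R] [Fintype S] [DecidableEq S] (M : Matrix R S ℂ) : ℝ :=
  (Matrix.trace (CFC.sqrt (Mᴴ * M))).re

/-- The reduced matrix `ρ_A = Tr_B ρ`, the partial trace over the second subsystem. -/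
def reducedA {A B : Type*} [Fintype B] (ρ : Matrix (A × B) (A × B) ℂ) : Matrix A A ℂ :=
  Matrix.of fun i j => ∑ k : B, ρ (i, k) (j, k)

/-- The reduced matrix `ρ_B = Tr_A ρ`, the partial trace over the first subsystem. -/
def reducedB {A B : Type*} [Fintype A] (ρ : Matrix (A × B) (A × B) ℂ) : Matrix B B ℂ :=
  Matrix.of fun k l => ∑ i : A, ρ (i, k) (i, l)

/-- The block `Z_{i,j}` of a matrix on `A × B`, seen as a block matrix indexed by `A`. -/
def block {A B : Type*} (Z : Matrix (A × B) (A × B) ℂ) (i j : A) : Matrix B B ℂ :=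
  Matrix.of fun k l => Z (i, k) (j, l)

/-- The realigned matrix `R(Z)`: its rows are the vectors `Vec(Z_{i,j})ᵀ`, listed in the order
of `Vec`. `Matrix.vec` indexes the column-stacking vectorization by pairs (column, row), so the
row with index `(j, i)` is `Vec(Z_{i,j})ᵀ`. -/
def realign {A B : Type*} (Z : Matrix (A × B) (A × B) ℂ) : Matrix (A × A) (B × B) ℂ :=
  Matrix.of fun q => Matrix.vec (block Z q.2 q.1)

/-- A real vector, regarded as a complex one. -/
def toComplex {n : ℕ} (v : EuclideanSpace ℝ (Fin n)) : Fin n → ℂ := fun i => (v i : ℂ)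

/-- The block matrix
`Q_{μ,ν}(ρ) = [ μ νᵀ , μ Vec(ρ_B)ᵀ ; Vec(ρ_A) νᵀ , R(ρ) ]`. -/
def Q {A B : Type*} [Fintype A] [Fintype B] {n m : ℕ}
    (μ : EuclideanSpace ℝ (Fin n)) (ν : EuclideanSpace ℝ (Fin m))
    (ρ : Matrix (A × B) (A × B) ℂ) : Matrix (Fin n ⊕ A × A) (Fin m ⊕ B × B) ℂ :=
  Matrix.fromBlocks
    (Matrix.vecMulVec (toComplex μ) (toComplex ν))
    (Matrix.vecMulVec (toComplex μ) (reducedB ρ).vec)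
    (Matrix.vecMulVec (reducedA ρ).vec (toComplex ν))
    (realign ρ)

/-- The matrix `|φ⟩⟨φ|`. -/
def ketBra {S : Type*} [Fintype S] (φ : EuclideanSpace ℂ S) : Matrix S S ℂ :=
  Matrix.of fun s t => φ s * star (φ t)

/-- The concurrence `√(2 (1 - Tr ρ_A²))` of a pure state `φ`, where `ρ_A = Tr_B |φ⟩⟨φ|`. -/
def pureConcurrence {A B : Type*} [Fintype A] [Fintype B] (φ : EuclideanSpace ℂ (A × B)) : ℝ :=
  √(2 * (1 - (Matrix.trace (reducedA (ketBra φ) * reducedA (ketBra φ))).re))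

/-- `{p_i, φ_i}` is a decomposition of `ρ` into an ensemble of pure states: `ρ = ∑ p_i |φ_i⟩⟨φ_i|`
with unit vectors `φ_i` and probabilities `p_i`. -/
structure IsEnsemble {S : Type*} [Fintype S] (ρ : Matrix S S ℂ) {k : ℕ}
    (p : Fin k → ℝ) (φ : Fin k → EuclideanSpace ℂ S) : Prop where
  nonneg : ∀ i, 0 ≤ p i
  sum_eq_one : ∑ i, p i = 1
  norm_eq_one : ∀ i, ‖φ i‖ = 1
  eq_sum : ρ = ∑ i, (p i : ℂ) • ketBra (φ i)

/-- The concurrence of a mixed state: the infimum of `∑ p_i C(φ_i)` over all finite ensemble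
decompositions of `ρ` into pure states. -/
def concurrence {A B : Type*} [Fintype A] [Fintype B] (ρ : Matrix (A × B) (A × B) ℂ) : ℝ :=
  sInf {c : ℝ | ∃ (k : ℕ) (p : Fin k → ℝ) (φ : Fin k → EuclideanSpace ℂ (A × B)),
    IsEnsemble ρ p φ ∧ c = ∑ i, p i * pureConcurrence (φ i)}

end BipartiteState

end

namespace BipartiteState

/-! The trace norm of `Q μ ν ρ` equals `Re Tr (W Q)` for some `W` with `|Tr (W x yᵀ)| ≤ ‖x‖ ‖y‖`
(`exists_contraction_trace_eq_traceNorm`). This pairing is linear and `Q` respects convex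
combinations (`Q_eq_sum`), so it suffices to bound `Re Tr (W Q)` on pure states and average over an
arbitrary ensemble.

For a pure state with Schmidt coefficients `s_p`, `Q` is a sum of rank-one matrices (`Q_ketBra_eq`).
The diagonal ones carry all the `μ`, `ν` borders and have size `s_p² √((‖μ‖²+1)(‖ν‖²+1))`; since `∑
s_p² = 1`, they contribute at most the subtracted constant. The others, for `p ≠ q`, have size `s_p
s_q`. Cauchy–Schwarz over at most `d(d-1)` pairs bounds their sum by `√(d(d-1)) √(1 - ∑ s_p⁴)`,
which is `√(d(d-1)/2)` times the concurrence. -/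

/-! ### Duality for the trace norm. -/

/-- Bessel's inequality in a form that admits zero vectors, as needed for vanishing singular values.
Expand `0 ≤ ‖v - x‖²` with `v = ∑ ⟨f i, x⟩ f i` and use `‖v‖² ≤ ⟨v, x⟩`. -/
theorem sum_norm_inner_sq_le {ι E : Type*} [Fintype ι] [NormedAddCommGroup E]
    [InnerProductSpace ℂ E] (f : ι → E) (horth : ∀ i j, i ≠ j → inner ℂ (f i) (f j) = 0)
    (hnorm : ∀ i, ‖f i‖ ≤ 1) (x : E) :
    ∑ i, ‖inner ℂ (f i) x‖ ^ 2 ≤ ‖x‖ ^ 2 := by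
  classical
  set v : E := ∑ i, inner ℂ (f i) x • f i with hv
  have hvx : inner ℂ v x = ((∑ i, ‖inner ℂ (f i) x‖ ^ 2 : ℝ) : ℂ) := by
    rw [hv, sum_inner]
    push_cast
    refine Finset.sum_congr rfl fun i _ => ?_
    rw [inner_smul_left, mul_comm, Complex.mul_conj, Complex.normSq_eq_norm_sq]
    push_cast
    rfl
  have hvv : inner ℂ v v = ((∑ i, ‖inner ℂ (f i) x‖ ^ 2 * ‖f i‖ ^ 2 : ℝ) : ℂ) := by
    rw [hv, sum_inner]
    push_cast
    refine Finset.sum_congr rfl fun i _ => ?_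
    rw [inner_sum, Finset.sum_eq_single i]
    · rw [inner_smul_left, inner_smul_right, inner_self_eq_norm_sq_to_K, ← mul_assoc,
        mul_comm ((starRingEnd ℂ) _), Complex.mul_conj, Complex.normSq_eq_norm_sq]
      push_cast
      rfl
    · intro j _ hj
      rw [inner_smul_left, inner_smul_right, horth i j hj.symm, mul_zero, mul_zero]
    · simp
  have hle : ∑ i, ‖inner ℂ (f i) x‖ ^ 2 * ‖f i‖ ^ 2 ≤ ∑ i, ‖inner ℂ (f i) x‖ ^ 2 := by
    refine Finset.sum_le_sum fun i _ => mul_le_of_le_one_right (by positivity) ?_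
    exact pow_le_one₀ (norm_nonneg _) (hnorm i)
  have hvn : ‖v‖ ^ 2 = ∑ i, ‖inner ℂ (f i) x‖ ^ 2 * ‖f i‖ ^ 2 := by
    apply Complex.ofReal_injective
    rw [← hvv, inner_self_eq_norm_sq_to_K]
    push_cast
    rfl
  have hsub := norm_sub_sq (𝕜 := ℂ) v x
  rw [hvx] at hsub
  simp only [RCLike.re_to_complex, Complex.ofReal_re] at hsub
  nlinarith [sq_nonneg ‖v - x‖]

theorem inner_eq_dotProduct {S : Type*} [Fintype S] (x y : EuclideanSpace ℂ S) :
    inner ℂ x y = ∑ s, star (x s) * y s := by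
  simp [PiLp.inner_apply, mul_comm]

/-- Used to see that `M` maps an orthonormal eigenbasis of `Mᴴ * M` to orthogonal vectors. -/
theorem inner_mulVec_mulVec_of_eigenvector {R S : Type*} [Fintype R] [Fintype S]
    (M : Matrix R S ℂ) (u v : EuclideanSpace ℂ S) (c : ℂ)
    (hv : (Mᴴ * M) *ᵥ v.ofLp = c • v.ofLp) :
    inner ℂ (WithLp.toLp 2 (M *ᵥ u.ofLp) : EuclideanSpace ℂ R) (WithLp.toLp 2 (M *ᵥ v.ofLp))
      = c * inner ℂ u v := by
  rw [EuclideanSpace.inner_eq_star_dotProduct, EuclideanSpace.inner_eq_star_dotProduct]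
  simp only
  rw [Matrix.star_mulVec, dotProduct_comm, ← Matrix.dotProduct_mulVec, Matrix.mulVec_mulVec, hv,
    dotProduct_smul, smul_eq_mul, dotProduct_comm]

/-- The trace norm is attained by pairing with a contraction. -/
theorem exists_contraction_trace_eq_traceNorm {R S : Type*} [Fintype R] [Fintype S]
    [DecidableEq S] (M : Matrix R S ℂ) :
    ∃ W : Matrix S R ℂ, traceNorm M = (Matrix.trace (W * M)).re ∧
      ∀ (x : EuclideanSpace ℂ R) (y : EuclideanSpace ℂ S),
        ‖Matrix.trace (W * Matrix.vecMulVec x.ofLp y.ofLp)‖ ≤ ‖x‖ * ‖y‖ := by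
  set P := CFC.sqrt (Mᴴ * M) with hP
  have hnn : (0 : Matrix S S ℂ) ≤ Mᴴ * M := (Matrix.posSemidef_conjTranspose_mul_self M).nonneg
  have hPP : P * P = Mᴴ * M := CFC.sqrt_mul_sqrt_self _ hnn
  have hPpos : P.PosSemidef := Matrix.nonneg_iff_posSemidef.mp (CFC.sqrt_nonneg _)
  have hH := hPpos.isHermitian
  set e := hH.eigenvectorBasis with he
  set σ := hH.eigenvalues with hσ
  have heig : ∀ j, (Mᴴ * M) *ᵥ (e j).ofLp = ((σ j : ℂ) ^ 2) • (e j).ofLp := by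
    intro j
    have h1 : P *ᵥ (e j).ofLp = σ j • (e j).ofLp := hH.mulVec_eigenvectorBasis j
    rw [← hPP, ← Matrix.mulVec_mulVec, h1, Matrix.mulVec_smul, h1]
    ext s
    simp [sq, mul_assoc]
  set g : S → EuclideanSpace ℂ R := fun j => WithLp.toLp 2 (M *ᵥ (e j).ofLp) with hg
  have hgg : ∀ i j, inner ℂ (g i) (g j) = (σ j : ℂ) ^ 2 * inner ℂ (e i) (e j) := fun i j =>
    inner_mulVec_mulVec_of_eigenvector M _ _ _ (heig j)
  have hgn : ∀ j, ‖g j‖ = σ j := by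
    intro j
    have h1 := inner_self_eq_norm_sq_to_K (𝕜 := ℂ) (g j)
    rw [hgg, inner_self_eq_norm_sq_to_K, e.orthonormal.1 j] at h1
    have h2 : σ j ^ 2 = ‖g j‖ ^ 2 := by
      have : ((σ j ^ 2 : ℝ) : ℂ) = ((‖g j‖ ^ 2 : ℝ) : ℂ) := by simpa using h1
      exact_mod_cast this
    exact ((sq_eq_sq₀ (hPpos.eigenvalues_nonneg j) (norm_nonneg _)).mp h2).symm
  -- Left singular vectors. If `σ j = 0`, the inverse is `0` and so is `f j`, hence only `‖f j‖ ≤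
  -- 1`.
  set f : S → EuclideanSpace ℂ R := fun j => ((σ j : ℂ)⁻¹) • g j with hf
  have hforth : ∀ i j, i ≠ j → inner ℂ (f i) (f j) = 0 := by
    intro i j hij
    simp only [hf]
    rw [inner_smul_left, inner_smul_right, hgg, e.orthonormal.2 hij]
    simp
  have hfn : ∀ j, ‖f j‖ ≤ 1 := by
    intro j
    simp only [hf]
    rw [norm_smul, norm_inv, Complex.norm_real, hgn, Real.norm_eq_abs,
      abs_of_nonneg (hPpos.eigenvalues_nonneg j)]
    exact inv_mul_le_one
  -- The witness is `W = ∑ |e j⟩⟨f j|`, the adjoint of the partial isometry in the polar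
  -- decomposition of `M`.
  have htr : ∀ N : Matrix R S ℂ,
      Matrix.trace ((Matrix.of fun s r => ∑ j, e j s * star (f j r)) * N)
        = ∑ j, inner ℂ (f j) (WithLp.toLp 2 (N *ᵥ (e j).ofLp) : EuclideanSpace ℂ R) := by
    intro N
    simp only [inner_eq_dotProduct, Matrix.trace, Matrix.diag, Matrix.mul_apply, Matrix.of_apply,
      Matrix.mulVec, dotProduct, Finset.sum_mul, Finset.mul_sum]
    rw [Finset.sum_comm]
    conv_rhs => rw [Finset.sum_comm]
    refine Finset.sum_congr rfl fun r _ => ?_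
    rw [Finset.sum_comm]
    refine Finset.sum_congr rfl fun j _ => Finset.sum_congr rfl fun s _ => ?_
    ring
  refine ⟨Matrix.of fun s r => ∑ j, e j s * star (f j r), ?_, ?_⟩
  · rw [htr, traceNorm, ← hP, hH.trace_eq_sum_eigenvalues]
    congr 1
    refine Finset.sum_congr rfl fun j _ => ?_
    change _ = inner ℂ (f j) (g j)
    simp only [hf]
    rw [inner_smul_left, inner_self_eq_norm_sq_to_K, hgn]
    simp only [map_inv₀, Complex.conj_ofReal]
    change (σ j : ℂ) = (σ j : ℂ)⁻¹ * (σ j : ℂ) ^ 2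
    by_cases h : (σ j : ℂ) = 0
    · simp [h]
    · field_simp
  · intro x y
    rw [htr]
    -- `vecMulVec` does not conjugate `y`, whereas the inner product conjugates its first argument.
    set y' : EuclideanSpace ℂ S := WithLp.toLp 2 (star y.ofLp) with hy'
    have hyn : ‖y'‖ = ‖y‖ := by simp [hy', EuclideanSpace.norm_eq]
    have hterm : ∀ j, inner ℂ (f j)
        (WithLp.toLp 2 (Matrix.vecMulVec x.ofLp y.ofLp *ᵥ (e j).ofLp) : EuclideanSpace ℂ R)
        = inner ℂ (f j) x * inner ℂ y' (e j) := by
      intro j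
      simp only [inner_eq_dotProduct, Matrix.mulVec, dotProduct, Matrix.vecMulVec_apply,
        Finset.mul_sum, Finset.sum_mul, hy', Pi.star_apply, star_star]
      rw [Finset.sum_comm]
      refine Finset.sum_congr rfl fun j _ => Finset.sum_congr rfl fun s _ => ?_
      ring
    simp only [hterm]
    calc ‖∑ j, inner ℂ (f j) x * inner ℂ y' (e j)‖
        ≤ ∑ j, ‖inner ℂ (f j) x‖ * ‖inner ℂ y' (e j)‖ := by
          refine (norm_sum_le _ _).trans (le_of_eq ?_)
          simp only [norm_mul]
      _ ≤ √(∑ j, ‖inner ℂ (f j) x‖ ^ 2) * √(∑ j, ‖inner ℂ y' (e j)‖ ^ 2) :=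
          Real.sum_mul_le_sqrt_mul_sqrt _ _ _
      _ ≤ ‖x‖ * ‖y‖ := by
          rw [e.sum_sq_norm_inner_left, hyn, Real.sqrt_sq (norm_nonneg _)]
          gcongr
          exact Real.sqrt_le_left (norm_nonneg _) |>.mpr (sum_norm_inner_sq_le f hforth hfn x)

/-! ### Schmidt decomposition and the off-diagonal sum. -/

/-- Schmidt decomposition with the coefficients absorbed in the first factor. -/
theorem exists_schmidt {A B : Type*} [Fintype A] [Fintype B] [DecidableEq B]
    (φ : EuclideanSpace ℂ (A × B)) :
    ∃ (g : B → EuclideanSpace ℂ A) (h : B → EuclideanSpace ℂ B),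
      (∀ p q, p ≠ q → inner ℂ (g p) (g q) = 0) ∧ Orthonormal ℂ h ∧
      ∀ a b, φ (a, b) = ∑ p, g p a * h p b := by
  set X : Matrix A B ℂ := Matrix.of fun a b => φ (a, b) with hX
  have hH : (Xᴴ * X).IsHermitian := Matrix.isHermitian_conjTranspose_mul_self X
  set e := hH.eigenvectorBasis with he
  -- Inserting `∑ |e p⟩⟨e p| = 1` gives `X = ∑ (X e_p) e_pᴴ`, whence the conjugate in the second
  -- factor. The norms of the `X e_p` are the Schmidt coefficients, zeros included.
  refine ⟨fun p => WithLp.toLp 2 (X *ᵥ (e p).ofLp), fun p => WithLp.toLp 2 (star (e p).ofLp),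
    ?_, ?_, ?_⟩
  · intro p q hpq
    rw [inner_mulVec_mulVec_of_eigenvector X _ _ (hH.eigenvalues q : ℂ)]
    · rw [e.orthonormal.2 hpq, mul_zero]
    · rw [hH.mulVec_eigenvectorBasis q]
      ext s
      simp [he]
  · rw [orthonormal_iff_ite]
    intro i j
    have h1 := orthonormal_iff_ite.mp e.orthonormal j i
    rw [inner_eq_dotProduct] at h1 ⊢
    simp only [Pi.star_apply, star_star]
    rw [show (if i = j then (1 : ℂ) else 0) = if j = i then 1 else 0 by simp only [eq_comm], ← h1]
    exact Finset.sum_congr rfl fun s _ => mul_comm _ _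
  · intro a b
    have h1 : ∀ c, ∑ p, e p c * star (e p b) = if c = b then 1 else 0 := by
      intro c
      have h2 := congrArg (fun v : EuclideanSpace ℂ B => v c)
        (e.sum_repr' (EuclideanSpace.single b (1 : ℂ)))
      simp only [EuclideanSpace.inner_single_right, one_mul, WithLp.ofLp_sum, Finset.sum_apply,
        WithLp.ofLp_smul, Pi.smul_apply, smul_eq_mul, PiLp.single_apply] at h2
      rw [← h2]
      exact Finset.sum_congr rfl fun s _ => mul_comm _ _
    have h3 : ∑ c, X a c * ∑ p, e p c * star (e p b) = φ (a, b) := by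
      simp only [h1, hX, Matrix.of_apply, mul_ite, mul_one, mul_zero, Finset.sum_ite_eq',
        Finset.mem_univ, if_true]
    rw [← h3]
    simp only [Matrix.mulVec, dotProduct, Finset.mul_sum, Finset.sum_mul, Pi.star_apply]
    rw [Finset.sum_comm]
    refine Finset.sum_congr rfl fun p _ => Finset.sum_congr rfl fun s _ => ?_
    ring

/-- Cauchy–Schwarz over ordered pairs in the support of `s`. Restricting to the support matters
because the index type may have more than `d` elements. -/
theorem sum_offDiag_le {ι : Type*} [Fintype ι] [DecidableEq ι] (s : ι → ℝ) (d : ℕ)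
    (hcard : (Finset.univ.filter fun p => s p ≠ 0).card ≤ d) :
    ∑ x ∈ (Finset.univ : Finset ι).offDiag, s x.1 * s x.2
      ≤ √((d : ℝ) * ((d : ℝ) - 1)) * √((∑ p, s p ^ 2) ^ 2 - ∑ p, s p ^ 4) := by
  set K := Finset.univ.filter fun p => s p ≠ 0 with hK
  have hsub : K.offDiag ⊆ (Finset.univ : Finset ι).offDiag :=
    Finset.offDiag_mono (Finset.subset_univ _)
  have hzero : ∀ x ∈ (Finset.univ : Finset ι).offDiag, x ∉ K.offDiag → s x.1 * s x.2 = 0 := by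
    intro x hx hxK
    by_contra hne
    apply hxK
    rw [Finset.mem_offDiag] at hx ⊢
    simp only [hK, Finset.mem_filter, Finset.mem_univ, true_and]
    exact ⟨left_ne_zero_of_mul hne, right_ne_zero_of_mul hne, hx.2.2⟩
  have hsq : ∑ x ∈ K.offDiag, (s x.1 * s x.2) ^ 2 = (∑ p, s p ^ 2) ^ 2 - ∑ p, s p ^ 4 := by
    rw [Finset.sum_subset hsub fun x hx hxK => by rw [hzero x hx hxK]; simp]
    have h1 : (∑ p, s p ^ 2) ^ 2
        = ∑ x ∈ (Finset.univ : Finset ι) ×ˢ (Finset.univ : Finset ι), (s x.1 * s x.2) ^ 2 := by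
      rw [sq, Finset.sum_mul_sum, Finset.sum_product]
      simp only [mul_pow]
    rw [h1, ← Finset.diag_union_offDiag, Finset.sum_union (Finset.disjoint_diag_offDiag _),
      Finset.sum_diag, add_comm, eq_sub_iff_add_eq]
    congr 1
    exact Finset.sum_congr rfl fun p _ => by ring
  have hKd : ((K.offDiag.card : ℕ) : ℝ) ≤ (d : ℝ) * ((d : ℝ) - 1) := by
    have h1 : K.offDiag.card ≤ d * d - d := by
      rw [Finset.offDiag_card, ← Nat.mul_sub_one, ← Nat.mul_sub_one]
      gcongr
    have h2 : d ≤ d * d := Nat.le_mul_self d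
    calc ((K.offDiag.card : ℕ) : ℝ) ≤ ((d * d - d : ℕ) : ℝ) := by exact_mod_cast h1
      _ = _ := by rw [Nat.cast_sub h2]; push_cast; ring
  rw [← Finset.sum_subset hsub hzero, ← hsq, ← Real.sqrt_mul ((Nat.cast_nonneg _).trans hKd)]
  refine Real.le_sqrt_of_sq_le ((sq_sum_le_card_mul_sum_sq).trans ?_)
  gcongr

/-! ### Rank-one decomposition of `Q` on pure states. -/

/-- The vector with coordinates `u i * conj (v j)` at `(j, i)`. -/
def outer {S : Type*} [Fintype S] (u v : EuclideanSpace ℂ S) : EuclideanSpace ℂ (S × S) :=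
  WithLp.toLp 2 fun x => u x.2 * star (v x.1)

theorem norm_outer {S : Type*} [Fintype S] (u v : EuclideanSpace ℂ S) :
    ‖outer u v‖ = ‖u‖ * ‖v‖ := by
  rw [← sq_eq_sq₀ (norm_nonneg _) (by positivity), mul_pow, EuclideanSpace.norm_sq_eq,
    EuclideanSpace.norm_sq_eq, EuclideanSpace.norm_sq_eq, Fintype.sum_prod_type,
    Finset.sum_mul_sum, Finset.sum_comm]
  refine Finset.sum_congr rfl fun i _ => Finset.sum_congr rfl fun j _ => ?_
  simp [outer, mul_pow]

/-- The direct sum of a real multiple of a real vector and a complex vector. -/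
def joinVec {n : ℕ} {S : Type*} [Fintype S] (c : ℝ) (μ : EuclideanSpace ℝ (Fin n))
    (v : EuclideanSpace ℂ S) : EuclideanSpace ℂ (Fin n ⊕ S) :=
  WithLp.toLp 2 (Sum.elim (fun i => (c : ℂ) * toComplex μ i) v.ofLp)

theorem norm_joinVec_sq {n : ℕ} {S : Type*} [Fintype S] (c : ℝ) (μ : EuclideanSpace ℝ (Fin n))
    (v : EuclideanSpace ℂ S) : ‖joinVec c μ v‖ ^ 2 = c ^ 2 * ‖μ‖ ^ 2 + ‖v‖ ^ 2 := by
  rw [EuclideanSpace.norm_sq_eq, EuclideanSpace.norm_sq_eq, EuclideanSpace.norm_sq_eq]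
  simp [joinVec, toComplex, mul_pow, Finset.mul_sum]

section Schmidt

variable {A B : Type*} [Fintype A] [Fintype B]
  {φ : EuclideanSpace ℂ (A × B)} {g : B → EuclideanSpace ℂ A} {h : B → EuclideanSpace ℂ B}

theorem reducedA_ketBra_apply [DecidableEq B] (hh : Orthonormal ℂ h)
    (hφ : ∀ a b, φ (a, b) = ∑ p, g p a * h p b) (i j : A) :
    reducedA (ketBra φ) i j = ∑ p, g p i * star (g p j) := by
  have hh' := orthonormal_iff_ite.mp hh
  have key : ∀ p, g p i * star (g p j)
      = ∑ q, g p i * star (g q j) * inner ℂ (h q) (h p) := by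
    intro p
    simp [hh']
  simp only [key, inner_eq_dotProduct, reducedA, ketBra, Matrix.of_apply, hφ, star_sum, star_mul']
  simp only [Finset.sum_mul_sum]
  simp only [Finset.mul_sum]
  rw [Finset.sum_comm]
  refine Finset.sum_congr rfl fun p _ => ?_
  rw [Finset.sum_comm]
  refine Finset.sum_congr rfl fun q _ => Finset.sum_congr rfl fun b _ => ?_
  ring

theorem reducedB_ketBra_apply (hg : ∀ p q, p ≠ q → inner ℂ (g p) (g q) = 0)
    (hφ : ∀ a b, φ (a, b) = ∑ p, g p a * h p b) (k l : B) :
    reducedB (ketBra φ) k l = ∑ p, (‖g p‖ : ℂ) ^ 2 * (h p k * star (h p l)) := by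
  have key : ∀ p, (‖g p‖ : ℂ) ^ 2 * (h p k * star (h p l))
      = ∑ q, inner ℂ (g q) (g p) * (h p k * star (h q l)) := by
    intro p
    rw [Finset.sum_eq_single p]
    · rw [inner_self_eq_norm_sq_to_K]
      rfl
    · intro q _ hq
      rw [hg q p hq, zero_mul]
    · simp
  simp only [key, inner_eq_dotProduct, reducedB, ketBra, Matrix.of_apply, hφ, star_sum, star_mul']
  simp only [Finset.sum_mul_sum]
  simp only [Finset.sum_mul]
  rw [Finset.sum_comm]
  refine Finset.sum_congr rfl fun p _ => ?_
  rw [Finset.sum_comm]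
  refine Finset.sum_congr rfl fun q _ => Finset.sum_congr rfl fun b _ => ?_
  ring

/-- Both sides are the trace of `ρ_B`. -/
theorem sum_norm_sq_schmidt (hg : ∀ p q, p ≠ q → inner ℂ (g p) (g q) = 0)
    (hh : Orthonormal ℂ h) (hφ : ∀ a b, φ (a, b) = ∑ p, g p a * h p b) :
    ∑ p, ‖g p‖ ^ 2 = ‖φ‖ ^ 2 := by
  have h1 : Matrix.trace (reducedB (ketBra φ)) = ((‖φ‖ ^ 2 : ℝ) : ℂ) := by
    rw [EuclideanSpace.norm_sq_eq, Fintype.sum_prod_type, Finset.sum_comm]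
    push_cast
    simp only [Matrix.trace, Matrix.diag, reducedB, ketBra, Matrix.of_apply]
    refine Finset.sum_congr rfl fun b _ => Finset.sum_congr rfl fun a _ => ?_
    rw [← Complex.ofReal_pow, ← Complex.normSq_eq_norm_sq, ← Complex.mul_conj]
    rfl
  have h2 : Matrix.trace (reducedB (ketBra φ)) = ((∑ p, ‖g p‖ ^ 2 : ℝ) : ℂ) := by
    simp only [Matrix.trace, Matrix.diag, reducedB_ketBra_apply hg hφ]
    rw [Finset.sum_comm]
    push_cast
    refine Finset.sum_congr rfl fun p _ => ?_
    rw [← Finset.mul_sum]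
    have h3 : inner ℂ (h p) (h p) = (1 : ℂ) := by
      rw [inner_self_eq_norm_sq_to_K, hh.1 p]
      simp
    rw [inner_eq_dotProduct] at h3
    simp only [mul_comm (h p _)]
    rw [h3, mul_one]
  exact Complex.ofReal_injective (h2.symm.trans h1)

/-- `Tr ρ_A²` is the trace of the squared Gram matrix of `g`, which is diagonal with entries `‖g
p‖²`. -/
theorem trace_reducedA_sq [DecidableEq B] (hg : ∀ p q, p ≠ q → inner ℂ (g p) (g q) = 0)
    (hh : Orthonormal ℂ h) (hφ : ∀ a b, φ (a, b) = ∑ p, g p a * h p b) :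
    Matrix.trace (reducedA (ketBra φ) * reducedA (ketBra φ)) = ((∑ p, ‖g p‖ ^ 4 : ℝ) : ℂ) := by
  have key : ∀ p, ((‖g p‖ ^ 4 : ℝ) : ℂ) = ∑ q, inner ℂ (g p) (g q) * inner ℂ (g q) (g p) := by
    intro p
    rw [Finset.sum_eq_single p]
    · rw [inner_self_eq_norm_sq_to_K]
      push_cast
      change _ = (‖g p‖ : ℂ) ^ 2 * (‖g p‖ : ℂ) ^ 2
      ring
    · intro q _ hq
      rw [hg q p hq, mul_zero]
    · simp
  rw [Complex.ofReal_sum]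
  simp only [key, inner_eq_dotProduct, Matrix.trace, Matrix.diag, Matrix.mul_apply,
    reducedA_ketBra_apply hh hφ, Finset.sum_mul_sum]
  simp only [← Finset.sum_product', Finset.univ_product_univ]
  refine Fintype.sum_equiv ⟨fun x => (x.2.2.1, x.2.2.2, x.2.1, x.1),
    fun x => (x.2.2.2, x.2.2.1, x.1, x.2.1), fun _ => rfl, fun _ => rfl⟩ _ _ fun x => ?_
  simp only [Equiv.coe_fn_mk]
  ring

/-- Realignment turns `|φ⟩⟨φ|` into a double sum over `(p, q)`. The terms `p = q` absorb the
borders, because both reduced matrices are diagonal in the Schmidt vectors and `∑ ‖g p‖² = 1` splits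
the corner. The factors `‖g p‖⁻¹` and `‖g p‖` give both joined vectors a norm proportional to `‖g
p‖`. -/
theorem Q_ketBra_eq [DecidableEq B] {n m : ℕ} (μ : EuclideanSpace ℝ (Fin n))
    (ν : EuclideanSpace ℝ (Fin m))
    (hnorm : ‖φ‖ = 1) (hg : ∀ p q, p ≠ q → inner ℂ (g p) (g q) = 0)
    (hh : Orthonormal ℂ h) (hφ : ∀ a b, φ (a, b) = ∑ p, g p a * h p b) :
    Q μ ν (ketBra φ)
      = (∑ p, Matrix.vecMulVec
          (joinVec ‖g p‖ μ ((‖g p‖⁻¹ : ℂ) • outer (g p) (g p))).ofLp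
          (joinVec ‖g p‖ ν ((‖g p‖ : ℂ) • outer (h p) (h p))).ofLp)
        + ∑ x ∈ (Finset.univ : Finset B).offDiag, Matrix.vecMulVec
          (joinVec 0 μ (outer (g x.1) (g x.2))).ofLp
          (joinVec 0 ν (outer (h x.1) (h x.2))).ofLp := by
  have hsum : ∑ p, (‖g p‖ : ℂ) ^ 2 = 1 := by
    have h1 := sum_norm_sq_schmidt hg hh hφ
    rw [hnorm] at h1
    have h2 := congrArg (fun x : ℝ => (x : ℂ)) h1
    simpa using h2
  -- Multiplication by `g p i` keeps the cancellation valid when `g p = 0`.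
  have hcancel : ∀ p (i : A), (‖g p‖ : ℂ)⁻¹ * (‖g p‖ : ℂ) * g p i = g p i := by
    intro p i
    by_cases h0 : g p = 0
    · simp [h0]
    · rw [inv_mul_cancel₀ (by simpa using h0), one_mul]
  ext r c
  rw [Matrix.add_apply, Matrix.sum_apply, Matrix.sum_apply]
  rcases r with i | i <;> rcases c with j | j <;>
    simp only [Q, Matrix.fromBlocks_apply₁₁, Matrix.fromBlocks_apply₁₂, Matrix.fromBlocks_apply₂₁,
      Matrix.fromBlocks_apply₂₂, Matrix.vecMulVec_apply, joinVec, Sum.elim_inl, Sum.elim_inr,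
      Complex.ofReal_zero, zero_mul, mul_zero, Finset.sum_const_zero, add_zero, Matrix.vec,
      realign, block, Matrix.of_apply, outer, WithLp.ofLp_smul, Pi.smul_apply, smul_eq_mul]
  · rw [← one_mul (toComplex μ i * toComplex ν j), ← hsum, Finset.sum_mul]
    exact Finset.sum_congr rfl fun p _ => by ring
  · rw [reducedB_ketBra_apply hg hφ, Finset.mul_sum]
    exact Finset.sum_congr rfl fun p _ => by ring
  · rw [reducedA_ketBra_apply hh hφ, Finset.sum_mul]
    refine Finset.sum_congr rfl fun p _ => ?_
    nth_rw 1 [← hcancel p i.2]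
    ring
  · simp only [ketBra, Matrix.of_apply, hφ, star_sum, star_mul']
    rw [Finset.sum_mul_sum, ← Finset.sum_product', ← Finset.diag_union_offDiag,
      Finset.sum_union (Finset.disjoint_diag_offDiag _), Finset.sum_diag]
    congr 1
    · refine Finset.sum_congr rfl fun p _ => ?_
      nth_rw 1 [← hcancel p i.2]
      ring
    · exact Finset.sum_congr rfl fun p _ => by ring

/-- The nonzero `g p` are orthogonal, hence linearly independent in `ℂ^A`, and they are indexed by
`B`. -/
theorem card_schmidt_le (hg : ∀ p q, p ≠ q → inner ℂ (g p) (g q) = 0) :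
    (Finset.univ.filter fun p => ‖g p‖ ≠ 0).card ≤ min (Fintype.card A) (Fintype.card B) := by
  refine le_min ?_ (Finset.card_le_univ _)
  set K := Finset.univ.filter fun p => ‖g p‖ ≠ 0 with hK
  have hli : LinearIndependent ℂ fun p : K => g p := by
    refine linearIndependent_of_ne_zero_of_inner_eq_zero (fun p => ?_) fun p q hpq => ?_
    · exact norm_ne_zero_iff.mp (Finset.mem_filter.mp p.2).2
    · exact hg _ _ fun h0 => hpq (Subtype.ext h0)
  simpa using hli.fintype_card_le_finrank

end Schmidt

/-! ### The bound for pure states and its extension to mixtures. -/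

/-- Stated for an arbitrary contractive `W`, so that the single `W` attaining the trace norm of the
mixed `Q` serves every state of an ensemble; no triangle inequality for `traceNorm` is needed. -/
theorem re_trace_mul_Q_ketBra_le {A B : Type*} [Fintype A] [Fintype B] [DecidableEq B]
    {n m : ℕ} (μ : EuclideanSpace ℝ (Fin n)) (ν : EuclideanSpace ℝ (Fin m))
    (W : Matrix (Fin m ⊕ B × B) (Fin n ⊕ A × A) ℂ)
    (hW : ∀ (x : EuclideanSpace ℂ (Fin n ⊕ A × A)) (y : EuclideanSpace ℂ (Fin m ⊕ B × B)),
      ‖Matrix.trace (W * Matrix.vecMulVec x.ofLp y.ofLp)‖ ≤ ‖x‖ * ‖y‖)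
    (φ : EuclideanSpace ℂ (A × B)) (hnorm : ‖φ‖ = 1) (d : ℕ)
    (hd : d = min (Fintype.card A) (Fintype.card B)) :
    (Matrix.trace (W * Q μ ν (ketBra φ))).re
      ≤ √((‖μ‖ ^ 2 + 1) * (‖ν‖ ^ 2 + 1))
        + √((d : ℝ) * ((d : ℝ) - 1)) / √2 * pureConcurrence φ := by
  obtain ⟨g, h, hg, hh, hφ⟩ := exists_schmidt φ
  have hsum : ∑ p, ‖g p‖ ^ 2 = 1 := by rw [sum_norm_sq_schmidt hg hh hφ, hnorm, one_pow]
  rw [Q_ketBra_eq μ ν hnorm hg hh hφ, Matrix.mul_add, Matrix.trace_add, Complex.add_re,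
    Matrix.mul_sum, Matrix.mul_sum, Matrix.trace_sum, Matrix.trace_sum, Complex.re_sum,
    Complex.re_sum]
  refine add_le_add ?_ ?_
  · calc _ ≤ ∑ p, ‖g p‖ ^ 2 * √((‖μ‖ ^ 2 + 1) * (‖ν‖ ^ 2 + 1)) := by
          refine Finset.sum_le_sum fun p _ =>
            ((Complex.re_le_norm _).trans (hW _ _)).trans ?_
          have hx : ‖joinVec ‖g p‖ μ ((‖g p‖⁻¹ : ℂ) • outer (g p) (g p))‖
              = ‖g p‖ * √(‖μ‖ ^ 2 + 1) := by
            rw [← sq_eq_sq₀ (norm_nonneg _) (by positivity), norm_joinVec_sq, norm_smul,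
              norm_outer, norm_inv, Complex.norm_real, norm_norm, mul_pow _ (√_),
              Real.sq_sqrt (by positivity), ← mul_assoc, inv_mul_mul_self]
            ring
          have hy : ‖joinVec ‖g p‖ ν ((‖g p‖ : ℂ) • outer (h p) (h p))‖
              = ‖g p‖ * √(‖ν‖ ^ 2 + 1) := by
            rw [← sq_eq_sq₀ (norm_nonneg _) (by positivity), norm_joinVec_sq, norm_smul,
              norm_outer, hh.1 p, Complex.norm_real, norm_norm, mul_pow _ (√_),
              Real.sq_sqrt (by positivity)]
            ring
          rw [hx, hy, Real.sqrt_mul (by positivity)]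
          exact le_of_eq (by ring)
      _ = √((‖μ‖ ^ 2 + 1) * (‖ν‖ ^ 2 + 1)) := by rw [← Finset.sum_mul, hsum, one_mul]
  · have hC : pureConcurrence φ = √2 * √(1 - ∑ p, ‖g p‖ ^ 4) := by
      rw [pureConcurrence, trace_reducedA_sq hg hh hφ, Complex.ofReal_re,
        Real.sqrt_mul (by norm_num)]
    calc _ ≤ ∑ x ∈ (Finset.univ : Finset B).offDiag, ‖g x.1‖ * ‖g x.2‖ := by
          refine Finset.sum_le_sum fun x _ =>
            ((Complex.re_le_norm _).trans (hW _ _)).trans ?_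
          have hx : ‖joinVec 0 μ (outer (g x.1) (g x.2))‖ = ‖g x.1‖ * ‖g x.2‖ := by
            rw [← sq_eq_sq₀ (norm_nonneg _) (by positivity), norm_joinVec_sq, norm_outer]
            ring
          have hy : ‖joinVec 0 ν (outer (h x.1) (h x.2))‖ = 1 := by
            rw [← sq_eq_sq₀ (norm_nonneg _) (by positivity), norm_joinVec_sq, norm_outer,
              hh.1, hh.1]
            ring
          rw [hx, hy, mul_one]
      _ ≤ √((d : ℝ) * ((d : ℝ) - 1)) * √((∑ p, ‖g p‖ ^ 2) ^ 2 - ∑ p, ‖g p‖ ^ 4) :=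
          sum_offDiag_le _ d (hd ▸ card_schmidt_le hg)
      _ = √((d : ℝ) * ((d : ℝ) - 1)) / √2 * pureConcurrence φ := by
          rw [hC, hsum, one_pow]
          field_simp

/-- `Q` is not linear in `ρ`, as its corner `μ νᵀ` is constant; `∑ p i = 1` makes up for this. -/
theorem Q_eq_sum {A B : Type*} [Fintype A] [Fintype B] {n m k : ℕ}
    (μ : EuclideanSpace ℝ (Fin n)) (ν : EuclideanSpace ℝ (Fin m))
    {ρ : Matrix (A × B) (A × B) ℂ} {p : Fin k → ℝ} {φ : Fin k → EuclideanSpace ℂ (A × B)}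
    (hens : IsEnsemble ρ p φ) :
    Q μ ν ρ = ∑ i, (p i : ℂ) • Q μ ν (ketBra (φ i)) := by
  have hsum : ∑ i, (p i : ℂ) = 1 := by
    have h2 := congrArg (fun x : ℝ => (x : ℂ)) hens.sum_eq_one
    simpa using h2
  rw [hens.eq_sum]
  ext r c
  rw [Matrix.sum_apply]
  rcases r with i | i <;> rcases c with j | j <;>
    simp only [Q, Matrix.fromBlocks_apply₁₁, Matrix.fromBlocks_apply₁₂, Matrix.fromBlocks_apply₂₁,
      Matrix.fromBlocks_apply₂₂, Matrix.vecMulVec_apply, Matrix.smul_apply, Matrix.vec,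
      realign, block, reducedA, reducedB, Matrix.of_apply, Matrix.sum_apply, smul_eq_mul]
  · rw [← Finset.sum_mul, hsum, one_mul]
  · rw [Finset.sum_comm, Finset.mul_sum]
    exact Finset.sum_congr rfl fun p _ => by rw [← Finset.mul_sum]; ring
  · rw [Finset.sum_comm, Finset.sum_mul]
    exact Finset.sum_congr rfl fun p _ => by rw [← Finset.mul_sum]; ring

/-- Every density matrix has an ensemble decomposition, by the spectral theorem. -/
theorem IsDensityMatrix.exists_isEnsemble {S : Type*} [Fintype S] [DecidableEq S]
    {ρ : Matrix S S ℂ} (hρ : IsDensityMatrix ρ) :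
    ∃ (k : ℕ) (p : Fin k → ℝ) (φ : Fin k → EuclideanSpace ℂ S), IsEnsemble ρ p φ := by
  have hH := hρ.posSemidef.isHermitian
  set σ := Fintype.equivFin S
  have htr : ∑ s, hH.eigenvalues s = 1 := by
    have h1 := hH.trace_eq_sum_eigenvalues
    rw [hρ.trace_eq_one] at h1
    apply Complex.ofReal_injective
    push_cast
    exact h1.symm
  refine ⟨Fintype.card S, fun i => hH.eigenvalues (σ.symm i),
    fun i => hH.eigenvectorBasis (σ.symm i),
    fun i => hρ.posSemidef.eigenvalues_nonneg _, ?_, fun i => hH.eigenvectorBasis.orthonormal.1 _,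
    ?_⟩
  · rw [σ.symm.sum_comp hH.eigenvalues, htr]
  · rw [σ.symm.sum_comp fun s => (hH.eigenvalues s : ℂ) • ketBra (hH.eigenvectorBasis s)]
    nth_rw 1 [hH.spectral_theorem]
    ext s t
    rw [Unitary.conjStarAlgAut_apply, Matrix.mul_apply, Matrix.sum_apply]
    refine Finset.sum_congr rfl fun j _ => ?_
    simp only [Matrix.mul_diagonal, Matrix.IsHermitian.eigenvectorUnitary_apply, ketBra,
      Matrix.star_apply, Matrix.smul_apply, Matrix.of_apply, smul_eq_mul, Function.comp_apply]
    change _ * (hH.eigenvalues j : ℂ) * _ = _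
    ring

end BipartiteState

open BipartiteState

theorem theorem2 (dA dB n m : ℕ) (hA : 2 ≤ dA) (hB : 2 ≤ dB)
    (μ : EuclideanSpace ℝ (Fin n)) (ν : EuclideanSpace ℝ (Fin m))
    (ρ : Matrix (Fin dA × Fin dB) (Fin dA × Fin dB) ℂ)
    (hρ : BipartiteState.IsDensityMatrix ρ)
    (d : ℕ) (hd : d = min dA dB) :
    √2 / √((d : ℝ) * ((d : ℝ) - 1)) *
        (BipartiteState.traceNorm (BipartiteState.Q μ ν ρ)
          - √((‖μ‖ ^ 2 + 1) * (‖ν‖ ^ 2 + 1)))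
      ≤ BipartiteState.concurrence ρ := by
  have hd2 : (2 : ℝ) ≤ d := by
    rw [hd]
    exact_mod_cast le_min hA hB
  have hpos : 0 < √((d : ℝ) * ((d : ℝ) - 1)) := Real.sqrt_pos.mpr (by nlinarith)
  -- An ensemble must exist for the infimum to be meaningful: `sInf ∅ = 0` in `ℝ`.
  obtain ⟨k₀, p₀, φ₀, h₀⟩ := hρ.exists_isEnsemble
  refine le_csInf ⟨_, k₀, p₀, φ₀, h₀, rfl⟩ ?_
  rintro c ⟨k, p, φ, hens, rfl⟩
  obtain ⟨W, hWtr, hW⟩ := exists_contraction_trace_eq_traceNorm (Q μ ν ρ)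
  have hle : traceNorm (Q μ ν ρ) ≤ √((‖μ‖ ^ 2 + 1) * (‖ν‖ ^ 2 + 1))
      + √((d : ℝ) * ((d : ℝ) - 1)) / √2 * ∑ i, p i * pureConcurrence (φ i) := by
    calc traceNorm (Q μ ν ρ)
        = ∑ i, p i * (Matrix.trace (W * Q μ ν (ketBra (φ i)))).re := by
          rw [hWtr, Q_eq_sum μ ν hens, Matrix.mul_sum, Matrix.trace_sum, Complex.re_sum]
          refine Finset.sum_congr rfl fun i _ => ?_
          rw [Matrix.mul_smul, Matrix.trace_smul, smul_eq_mul, Complex.re_ofReal_mul]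
      _ ≤ ∑ i, p i * (√((‖μ‖ ^ 2 + 1) * (‖ν‖ ^ 2 + 1))
            + √((d : ℝ) * ((d : ℝ) - 1)) / √2 * pureConcurrence (φ i)) :=
          Finset.sum_le_sum fun i _ => mul_le_mul_of_nonneg_left
            (re_trace_mul_Q_ketBra_le μ ν W hW (φ i) (hens.norm_eq_one i) d (by simpa using hd))
            (hens.nonneg i)
      _ = _ := by
          simp only [mul_add, Finset.sum_add_distrib, ← Finset.sum_mul, hens.sum_eq_one, one_mul,
            Finset.mul_sum]
          congr 1
          exact Finset.sum_congr rfl fun i _ => by ring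
  rw [div_mul_eq_mul_div, div_le_iff₀ hpos]
  calc _ ≤ √2 * (√((d : ℝ) * ((d : ℝ) - 1)) / √2 * ∑ i, p i * pureConcurrence (φ i)) := by
        gcongr
        linarith
    _ = _ := by field_simp
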